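/- Let $p$ be a real polynomial in $n$ variables, homogeneous of degree $d$, and let $e\in\mathbb{R}^n$. Call $p$ *hyperbolic with respect to $e$* if $p(e)>0$ and, for every $x\in\mathbb{R}^n$, the univariate polynomial $t\mapsto p(te-x)$ has only real roots. The roots, counted with multiplicity, are the eigenvalues of $x$; let $\mathrm{rank}_p(x)$ be the number of nonzero eigenvalues and $\mathrm{mult}_p(x)=d-\mathrm{rank}_p(x)$. The hyperbolicity cone $\Lambda_+(p,e)$ is the set of $x\in\mathbb{R}^n$ all of whose eigenvalues are nonnegative (all of $\mathbb{R}^n$ if $d=0$). For a set $C\subseteq\mathbb{R}^n$ and $x\in C$, the tangent cone of $C$ at $x$ is the closure $\overline{\mathcal{K}_C(x)}$ of the cone of feasible directions $\mathcal{K}_C(x)=\mathrm{cone}\{z-x : z\in C\}$, where $\mathrm{cone}$ denotes the set of finite linear combinations with nonnegative coefficients. **Theorem 5.7.** Suppose that $p$ is hyperbolic with respect to $e$ and that $x\in\Lambda_+(p,e)$. Then the localization of $p$ at $x$, that is, the polynomial $\mathrm{loc}_x p$ of degree $\mathrm{mult}_p(x)$ given for all $y\in\mathbb{R}^n$ by $$(\mathrm{loc}_x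 p)(y)=\lim_{\lambda\to\infty}\lambda^{\mathrm{mult}_p(x)}\,p(x+\lambda^{-1}y)=\lim_{\lambda\to\infty}\lambda^{-\mathrm{rank}_p(x)}\,p(\lambda x+y),$$ exists and is unique, and 1. $\mathrm{loc}_x p$ is hyperbolic with respect to $e$; 2. $\Lambda_+(\mathrm{loc}_x p,e)=\overline{\mathcal{K}_{\Lambda_+(p,e)}(x)}$, the tangent cone of $\Lambda_+(p,e)$ at $x$. -/

import Mathlib

open Filter Topology

namespace HypPoly

noncomputable section

/-- The univariate polynomial `t ↦ p (t e - x)`. -/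
def charPoly {n : ℕ} (p : MvPolynomial (Fin n) ℝ) (e x : Fin n → ℝ) : Polynomial ℝ :=
  MvPolynomial.aeval (fun i => Polynomial.C (e i) * Polynomial.X - Polynomial.C (x i)) p

theorem eval_charPoly {n : ℕ} (p : MvPolynomial (Fin n) ℝ) (e x : Fin n → ℝ) (t : ℝ) :
    (charPoly p e x).eval t = MvPolynomial.eval (t • e - x) p := by
  induction p using MvPolynomial.induction_on with
  | C a => simp [charPoly, MvPolynomial.algHom_C]
  | add p q hp hq =>
    rw [charPoly, map_add, Polynomial.eval_add, map_add]
    exact congrArg₂ (· + ·) hp hq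
  | mul_X p i hp =>
    rw [charPoly, map_mul, Polynomial.eval_mul, map_mul]
    refine congrArg₂ (· * ·) hp ?_
    rw [MvPolynomial.aeval_X, MvPolynomial.eval_X, Polynomial.eval_sub, Polynomial.eval_mul,
      Polynomial.eval_C, Polynomial.eval_X, Polynomial.eval_C, Pi.sub_apply, Pi.smul_apply,
      smul_eq_mul, mul_comm]

/-- `p` is hyperbolic with respect to `e`: it is homogeneous (of degree `p.totalDegree`),
`p e > 0`, and each `t ↦ p (t e - x)` has only real roots, that is, it is a product of linear
factors over `ℝ` (it is not the zero polynomial, because `p e > 0`). -/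
structure IsHyperbolic {n : ℕ} (p : MvPolynomial (Fin n) ℝ) (e : Fin n → ℝ) : Prop where
  homogeneous : p.IsHomogeneous p.totalDegree
  pos : 0 < MvPolynomial.eval e p
  real_roots : ∀ x : Fin n → ℝ, (charPoly p e x).Splits

/-- The hyperbolic eigenvalues of `x`: the real roots of `t ↦ p (t e - x)`, with multiplicity. -/
def eigenvalues {n : ℕ} (p : MvPolynomial (Fin n) ℝ) (e x : Fin n → ℝ) : Multiset ℝ :=
  (charPoly p e x).roots

/-- The number of nonzero hyperbolic eigenvalues of `x`, with multiplicity. -/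
def rank {n : ℕ} (p : MvPolynomial (Fin n) ℝ) (e x : Fin n → ℝ) : ℕ :=
  ((eigenvalues p e x).filter (fun t => t ≠ 0)).card

/-- The multiplicity of `x`: `deg p - rank x`. -/
def mult {n : ℕ} (p : MvPolynomial (Fin n) ℝ) (e x : Fin n → ℝ) : ℕ :=
  p.totalDegree - rank p e x

/-- The closed hyperbolicity cone: the points whose smallest hyperbolic eigenvalue is
nonnegative, that is, all of whose eigenvalues are nonnegative (every point, when `p` is
a constant and there are no eigenvalues). -/
def hyperbolicityCone {n : ℕ} (p : MvPolynomial (Fin n) ℝ) (e : Fin n → ℝ) : Set (Fin n → ℝ) :=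
  {x | ∀ t ∈ eigenvalues p e x, 0 ≤ t}

/-- `q` is the localization of `p` at `x`: the polynomial of degree `m = mult x` with
`q y = lim l ^ m * p (x + l⁻¹ y) = lim l ^ (- rank x) * p (l x + y)` as `l → ∞`, for every `y`. -/
structure IsLocalization {n : ℕ} (p : MvPolynomial (Fin n) ℝ) (e x : Fin n → ℝ)
    (q : MvPolynomial (Fin n) ℝ) : Prop where
  degree : q.totalDegree = mult p e x
  tendsto_mult : ∀ y : Fin n → ℝ,
    Tendsto (fun l : ℝ => l ^ mult p e x * MvPolynomial.eval (x + l⁻¹ • y) p) atTop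
      (𝓝 (MvPolynomial.eval y q))
  tendsto_rank : ∀ y : Fin n → ℝ,
    Tendsto (fun l : ℝ => (l ^ rank p e x)⁻¹ * MvPolynomial.eval (l • x + y) p) atTop
      (𝓝 (MvPolynomial.eval y q))

/-- The cone of feasible directions `cone {z - x : z ∈ K}` from `x` into `K`, where `cone` is the
conic hull (the set of finite linear combinations with nonnegative coefficients). -/
def feasibleDirections {n : ℕ} (K : Set (Fin n → ℝ)) (x : Fin n → ℝ) : Set (Fin n → ℝ) :=
  (PointedCone.hull ℝ {v : Fin n → ℝ | ∃ z ∈ K, v = z - x} : Set (Fin n → ℝ))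

/-- The tangent cone of `K` at `x`: the closure of the cone of feasible directions. -/
def tangentCone {n : ℕ} (K : Set (Fin n → ℝ)) (x : Fin n → ℝ) : Set (Fin n → ℝ) :=
  closure (feasibleDirections K x)

end

end HypPoly

/-! The localization is the homogeneous part of degree `mult p e x` of `y ↦ p (x + y)`, and the crux
is that all lower parts vanish while this one does not. Along `e` this is elementary: `p (x + ε e) =
p e * ∏ (ε + λᵢ)` with the `λᵢ ≥ 0` the eigenvalues of `x`, so the order in `ε` is exactly the
number of zero eigenvalues and the leading coefficient is positive
(`exists_eval_add_smul_direction`). No direction `y` has lower order: by Gårding's theory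
(`of_mem_openCone`, `add_mem_openCone`) the polynomial `σ ↦ p (x + ε e + σ ε (y - e))` has no zero
in a disc about `0` whose radius does not depend on `ε`. A polynomial of bounded degree without
zeros in a disc is controlled by its value at the centre, so `|p (x + ε y)| ≤ C |p (x + ε e)|`
(`exists_abs_eval_le`).

The same growth estimate yields a Hurwitz principle, `limit_eq_zero_of_no_root_ball`: absence of
zeros in a disc survives limits, unless the limit is zero on a whole line, which homogeneity rules
out when `p` does not vanish at the direction of the line. It drives Gårding's theorems and, applied
to `ε ^ (-m) * p (x + ε (a + t e))` with `m = mult p e x` as `ε → 0`, gives hyperbolicity of the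
localization and the inclusion of the tangent cone in its cone.

For the reverse inclusion, let `y` lie in the cone of the localization and `δ > 0`. Then `x + ε (y +
δ e)` lies in the cone of `p` for some `ε > 0`: on the ray of points `y + τ e` with `τ ≥ δ`, a
compact piece is handled by uniform convergence to the localization, and the remainder lies in the
open cone of `p`. Letting `δ → 0` gives a point of the closure. -/

namespace HypPoly

/-! ### Growth of polynomials without roots in a disc, and a Hurwitz principle -/

section Growth

/-- Factor by factor: `‖t - a‖ ≤ ‖t - t₀‖ + ‖t₀ - a‖`, and the first summand is at most `‖t₀ - a‖ *
(‖t - t₀‖ / c)`. -/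
theorem prod_norm_sub_le {c : ℝ} (hc : 0 < c) {t₀ : ℂ} (t : ℂ) (s : Multiset ℂ)
    (hs : ∀ a ∈ s, c ≤ ‖t₀ - a‖) :
    (s.map fun a => ‖t - a‖).prod ≤
      (s.map fun a => ‖t₀ - a‖).prod * (1 + ‖t - t₀‖ / c) ^ s.card := by
  induction s using Multiset.induction_on with
  | empty => simp
  | cons a s ih =>
    have h1 := ih fun b hb => hs b (Multiset.mem_cons_of_mem hb)
    have h2 : c ≤ ‖t₀ - a‖ := hs a (Multiset.mem_cons_self a s)
    have h3 : ‖t - a‖ ≤ ‖t₀ - a‖ * (1 + ‖t - t₀‖ / c) := by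
      have h4 : ‖t - a‖ ≤ ‖t - t₀‖ + ‖t₀ - a‖ := by
        simpa using norm_add_le (t - t₀) (t₀ - a)
      have h5 : ‖t - t₀‖ ≤ ‖t₀ - a‖ * (‖t - t₀‖ / c) := by
        rw [mul_div_assoc', le_div_iff₀ hc, mul_comm]
        gcongr
      linarith
    rw [Multiset.map_cons, Multiset.prod_cons, Multiset.map_cons, Multiset.prod_cons,
      Multiset.card_cons, pow_succ]
    calc _ ≤ (‖t₀ - a‖ * (1 + ‖t - t₀‖ / c)) *
          ((s.map fun a => ‖t₀ - a‖).prod * (1 + ‖t - t₀‖ / c) ^ s.card) := by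
          refine mul_le_mul h3 h1 ?_ (by positivity)
          refine Multiset.prod_nonneg fun b hb => ?_
          obtain ⟨_, _, rfl⟩ := Multiset.mem_map.1 hb
          positivity
      _ = _ := by ring

theorem norm_eval_eq_prod (P : Polynomial ℂ) (t : ℂ) :
    ‖P.eval t‖ = ‖P.leadingCoeff‖ * (P.roots.map fun a => ‖t - a‖).prod := by
  rw [(IsAlgClosed.splits P).eval_eq_prod_roots, norm_mul]
  congr 1
  exact (Multiset.prod_hom' P.roots (normHom : ℂ →*₀ ℝ) (t - ·)).symm

/-- A complex polynomial without roots in a disc is controlled by its value at the centre. -/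
theorem norm_eval_le_of_no_root_ball {P : Polynomial ℂ} {d : ℕ} (hd : P.natDegree ≤ d) {c : ℝ}
    (hc : 0 < c) {t₀ : ℂ} (h : ∀ t, ‖t - t₀‖ < c → P.eval t ≠ 0) (t : ℂ) :
    ‖P.eval t‖ ≤ ‖P.eval t₀‖ * (1 + ‖t - t₀‖ / c) ^ d := by
  have key := prod_norm_sub_le hc (t₀ := t₀) t P.roots fun a ha => by
    by_contra! hlt
    rw [norm_sub_rev] at hlt
    exact h a hlt (Polynomial.isRoot_of_mem_roots ha)
  rw [norm_eval_eq_prod P t, norm_eval_eq_prod P t₀, mul_assoc]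
  refine mul_le_mul_of_nonneg_left (key.trans ?_) (norm_nonneg _)
  refine mul_le_mul_of_nonneg_left ?_ ?_
  · refine pow_le_pow_right₀ ?_ ((Polynomial.card_roots' P).trans hd)
    have : 0 ≤ ‖t - t₀‖ / c := by positivity
    linarith
  · refine Multiset.prod_nonneg fun b hb => ?_
    obtain ⟨_, _, rfl⟩ := Multiset.mem_map.1 hb
    positivity

/-- A Hurwitz-type theorem: if polynomials of bounded degree without roots in a disc converge
pointwise and the limit vanishes at the centre of the disc, then the limit is zero. -/
theorem limit_eq_zero_of_no_root_ball {ι : Type*} {l : Filter ι} [l.NeBot]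
    {P : ι → Polynomial ℂ} {d : ℕ} (hd : ∀ i, (P i).natDegree ≤ d) {c : ℝ} (hc : 0 < c) {t₀ : ℂ}
    (h : ∀ᶠ i in l, ∀ t, ‖t - t₀‖ < c → (P i).eval t ≠ 0) {g : ℂ → ℂ}
    (hg : ∀ t, Tendsto (fun i => (P i).eval t) l (𝓝 (g t))) (h0 : g t₀ = 0) (t : ℂ) :
    g t = 0 := by
  have h1 : Tendsto (fun i => ‖(P i).eval t₀‖ * (1 + ‖t - t₀‖ / c) ^ d) l (𝓝 0) := by
    have := ((hg t₀).norm).mul_const ((1 + ‖t - t₀‖ / c) ^ d)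
    simpa [h0] using this
  have h2 : ‖g t‖ ≤ 0 := le_of_tendsto_of_tendsto (hg t).norm h1
    (h.mono fun i hi => norm_eval_le_of_no_root_ball (hd i) hc hi t)
  exact norm_le_zero_iff.1 h2

end Growth

/-! ### Restrictions of a homogeneous polynomial to complex lines -/

section Line

variable {n : ℕ}

/-- The polynomial `t ↦ p (A + t V)`. -/
noncomputable def linePoly (p : MvPolynomial (Fin n) ℝ) (A V : Fin n → ℂ) : Polynomial ℂ :=
  MvPolynomial.aeval (fun i => Polynomial.C (A i) + Polynomial.C (V i) * Polynomial.X)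
    (p.map (algebraMap ℝ ℂ))

theorem eval_linePoly (p : MvPolynomial (Fin n) ℝ) (A V : Fin n → ℂ) (t : ℂ) :
    (linePoly p A V).eval t = MvPolynomial.aeval (A + t • V) p := by
  have h := MvPolynomial.comp_aeval_apply
    (fun i => Polynomial.C (A i) + Polynomial.C (V i) * Polynomial.X)
    (Polynomial.aeval t : Polynomial ℂ →ₐ[ℂ] ℂ) (p.map (algebraMap ℝ ℂ))
  rw [Polynomial.coe_aeval_eq_eval] at h
  have h2 : (fun i => Polynomial.eval t
      (Polynomial.C (A i) + Polynomial.C (V i) * Polynomial.X)) = A + t • V := by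
    funext i
    rw [Polynomial.eval_add, Polynomial.eval_mul, Polynomial.eval_C, Polynomial.eval_C,
      Polynomial.eval_X, Pi.add_apply, Pi.smul_apply, smul_eq_mul, mul_comm t]
  rw [linePoly, h, h2, MvPolynomial.aeval_map_algebraMap]

theorem natDegree_linePoly_le (p : MvPolynomial (Fin n) ℝ) (A V : Fin n → ℂ) :
    (linePoly p A V).natDegree ≤ (p.map (algebraMap ℝ ℂ)).totalDegree := by
  have h := MvPolynomial.aeval_natDegree_le (p.map (algebraMap ℝ ℂ)) le_rfl
    (fun i => Polynomial.C (A i) + Polynomial.C (V i) * Polynomial.X) (n := 1) fun i => by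
      compute_degree
  rwa [mul_one] at h

theorem continuous_aeval_complex (p : MvPolynomial (Fin n) ℝ) :
    Continuous fun Z : Fin n → ℂ => MvPolynomial.aeval Z p := by
  have : ∀ Z : Fin n → ℂ, MvPolynomial.aeval Z p
      = MvPolynomial.eval Z (p.map (algebraMap ℝ ℂ)) := fun Z => by
    rw [MvPolynomial.aeval_def, MvPolynomial.eval_map]
  simp only [this]
  exact MvPolynomial.continuous_eval _

theorem aeval_smul_of_isHomogeneous {A : Type*} [CommSemiring A] [Algebra ℝ A]
    {p : MvPolynomial (Fin n) ℝ} {d : ℕ} (hp : p.IsHomogeneous d) (t : A) (Z : Fin n → A) :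
    MvPolynomial.aeval (t • Z) p = t ^ d * MvPolynomial.aeval Z p := by
  rw [MvPolynomial.aeval_def, MvPolynomial.aeval_def, MvPolynomial.eval₂_eq,
    MvPolynomial.eval₂_eq, Finset.mul_sum]
  refine Finset.sum_congr rfl fun m hm => ?_
  have hdeg : ∑ i ∈ m.support, m i = d := (hp.degree_eq_sum_deg_support hm).symm
  simp only [Pi.smul_apply, smul_eq_mul, mul_pow, Finset.prod_mul_distrib]
  rw [Finset.prod_pow_eq_pow_sum, hdeg]
  ring

theorem eval_smul_of_isHomogeneous
    {p : MvPolynomial (Fin n) ℝ} {d : ℕ} (hp : p.IsHomogeneous d) (t : ℝ) (z : Fin n → ℝ) :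
    MvPolynomial.eval (t • z) p = t ^ d * MvPolynomial.eval z p := by
  simpa [MvPolynomial.aeval_eq_eval] using aeval_smul_of_isHomogeneous hp t z

/-- The real vector `a` seen as a complex vector. -/
def complexify (a : Fin n → ℝ) : Fin n → ℂ := fun i => (a i : ℂ)

theorem complexify_add (a b : Fin n → ℝ) :
    complexify (a + b) = complexify a + complexify b := by
  funext i; simp [complexify]

theorem complexify_smul (t : ℝ) (a : Fin n → ℝ) :
    complexify (t • a) = (t : ℂ) • complexify a := by
  funext i; simp [complexify]

theorem continuous_complexify : Continuous (complexify : (Fin n → ℝ) → Fin n → ℂ) := by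
  unfold complexify; fun_prop

theorem aeval_complexify (p : MvPolynomial (Fin n) ℝ) (a : Fin n → ℝ) :
    MvPolynomial.aeval (complexify a) p = ((MvPolynomial.eval a p : ℝ) : ℂ) := by
  have := MvPolynomial.comp_aeval_apply (R := ℝ) a (Algebra.ofId ℝ ℂ) p
  rw [MvPolynomial.aeval_eq_eval] at this
  exact this.symm

/-- A homogeneous polynomial vanishing on a whole line vanishes at its direction. -/
theorem aeval_direction_eq_zero {p : MvPolynomial (Fin n) ℝ} {d : ℕ} (hp : p.IsHomogeneous d)
    {A V : Fin n → ℂ} (h : ∀ t : ℂ, MvPolynomial.aeval (A + t • V) p = 0) :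
    MvPolynomial.aeval V p = 0 := by
  have h1 : ∀ t : ℂ, t ≠ 0 → MvPolynomial.aeval (V + t • A) p = 0 := fun t ht => by
    have : V + t • A = t • (A + t⁻¹ • V) := by
      rw [smul_add, smul_smul, mul_inv_cancel₀ ht, one_smul, add_comm]
    rw [this, aeval_smul_of_isHomogeneous hp, h, mul_zero]
  have h2 : Tendsto (fun t : ℂ => MvPolynomial.aeval (V + t • A) p) (𝓝[≠] 0)
      (𝓝 (MvPolynomial.aeval V p)) := by
    have : Continuous fun t : ℂ => MvPolynomial.aeval (V + t • A) p :=
      (continuous_aeval_complex p).comp (by fun_prop)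
    simpa using (this.tendsto 0).mono_left nhdsWithin_le_nhds
  refine tendsto_nhds_unique h2 (tendsto_const_nhds.congr' ?_)
  filter_upwards [self_mem_nhdsWithin] with t ht using (h1 t ht).symm

end Line

/-! ### Continuity of roots along a homotopy -/

section Homotopy

variable {n : ℕ}

/-- Since `p (A + t V) = t ^ d * p (V + t⁻¹ A)` and `p` has no zero near `V`, the vector `t⁻¹ A`
cannot be small. The bound keeps roots in a compact set when `A` varies in one. -/
theorem exists_root_bound {p : MvPolynomial (Fin n) ℝ} {d : ℕ} (hp : p.IsHomogeneous d)
    {V : Fin n → ℂ} (hV : MvPolynomial.aeval V p ≠ 0) :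
    ∃ δ > 0, ∀ A : Fin n → ℂ, ∀ t : ℂ, MvPolynomial.aeval (A + t • V) p = 0 →
      δ * ‖t‖ ≤ ‖A‖ := by
  obtain ⟨δ, hδ, hball⟩ := Metric.eventually_nhds_iff.1
    ((continuous_aeval_complex p).continuousAt.eventually_ne hV)
  refine ⟨δ, hδ, fun A t h => ?_⟩
  by_contra! hlt
  have ht : t ≠ 0 := by
    rintro rfl
    simp only [norm_zero, mul_zero] at hlt
    exact absurd hlt (norm_nonneg A).not_gt
  have htp : 0 < ‖t‖ := norm_pos_iff.2 ht
  have h1 : MvPolynomial.aeval (V + t⁻¹ • A) p ≠ 0 := by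
    refine hball ?_
    rw [dist_eq_norm, add_sub_cancel_left, norm_smul, norm_inv, inv_mul_lt_iff₀ htp, mul_comm]
    exact hlt
  refine h1 ?_
  have : A + t • V = t • (V + t⁻¹ • A) := by
    rw [smul_add, smul_smul, mul_inv_cancel₀ ht, one_smul, add_comm]
  rw [this, aeval_smul_of_isHomogeneous hp] at h
  exact (mul_eq_zero.1 h).resolve_left (pow_ne_zero _ ht)

/-- If, along a homotopy, roots in the closed set `W` always lie in the open set `U ⊆ W`, and there
are none at the start, then there are none at the end. -/
theorem no_root_of_homotopy {p : MvPolynomial (Fin n) ℝ} {d : ℕ} (hp : p.IsHomogeneous d)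
    {V : Fin n → ℂ} (hV : MvPolynomial.aeval V p ≠ 0) {A : unitInterval → Fin n → ℂ}
    (hA : Continuous A) {U W : Set ℂ} (hU : IsOpen U) (hW : IsClosed W) (hUW : U ⊆ W)
    (hroot : ∀ s, ∀ t ∈ W, MvPolynomial.aeval (A s + t • V) p = 0 → t ∈ U)
    (h0 : ∀ t ∈ U, MvPolynomial.aeval (A 0 + t • V) p ≠ 0) :
    ∀ t ∈ U, MvPolynomial.aeval (A 1 + t • V) p ≠ 0 := by
  set E : Set unitInterval := {s | ∃ t ∈ U, MvPolynomial.aeval (A s + t • V) p = 0} with hE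
  have hcont : Continuous fun x : unitInterval × ℂ =>
      MvPolynomial.aeval (A x.1 + x.2 • V) p :=
    (continuous_aeval_complex p).comp (by fun_prop)
  have hclosed : IsClosed E := by
    obtain ⟨δ, hδ, hb⟩ := exists_root_bound hp hV
    obtain ⟨M, hM⟩ := (isCompact_univ.image hA.norm).bddAbove
    -- Roots in `W` already lie in `U`, so the open condition can be traded for the closed one; `E`
    -- is then the projection of a compact set.
    have hEq : E = Prod.fst '' ((Set.univ ×ˢ Metric.closedBall (0 : ℂ) (M / δ)) ∩
        ({x : unitInterval × ℂ | x.2 ∈ W} ∩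
          {x : unitInterval × ℂ | MvPolynomial.aeval (A x.1 + x.2 • V) p = 0})) := by
      ext s
      constructor
      · rintro ⟨t, ht, h⟩
        refine ⟨(s, t), ⟨⟨Set.mem_univ _, ?_⟩, hUW ht, h⟩, rfl⟩
        rw [mem_closedBall_zero_iff, le_div_iff₀ hδ, mul_comm]
        exact (hb _ _ h).trans (hM ⟨s, Set.mem_univ _, rfl⟩)
      · rintro ⟨⟨s', t⟩, ⟨-, ht, h⟩, rfl⟩
        exact ⟨t, hroot _ t ht h, h⟩
    rw [hEq]
    refine (IsCompact.image ?_ continuous_fst).isClosed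
    refine (isCompact_univ.prod (isCompact_closedBall _ _)).inter_right ?_
    exact (hW.preimage continuous_snd).inter (isClosed_eq hcont continuous_const)
  -- If `s ∈ E` were a limit of parameters outside `E`, the Hurwitz principle near the root `t`
  -- would make `p` vanish on the whole line at `s`, hence at `V`.
  have hopen : IsOpen E := by
    rw [isOpen_iff_mem_nhds]
    rintro s ⟨t, ht, h⟩
    by_contra hn
    have hf : ∃ᶠ s' in 𝓝 s, s' ∉ E := fun hh => hn (by simpa using hh)
    have : (𝓝 s ⊓ 𝓟 Eᶜ).NeBot := frequently_mem_iff_neBot.1 hf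
    obtain ⟨c, hc, hball⟩ := Metric.isOpen_iff.1 hU t ht
    have hno : ∀ᶠ s' in 𝓝 s ⊓ 𝓟 Eᶜ, ∀ t', ‖t' - t‖ < c → (linePoly p (A s') V).eval t' ≠ 0 := by
      filter_upwards [mem_inf_of_right (mem_principal_self _)] with s' hs' t' ht' h'
      rw [eval_linePoly] at h'
      exact hs' ⟨t', hball (by rwa [Metric.mem_ball, dist_eq_norm]), h'⟩
    have htend : ∀ t', Tendsto (fun s' => (linePoly p (A s') V).eval t') (𝓝 s ⊓ 𝓟 Eᶜ)
        (𝓝 (MvPolynomial.aeval (A s + t' • V) p)) := fun t' => by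
      simp only [eval_linePoly]
      have : Continuous fun s' => MvPolynomial.aeval (A s' + t' • V) p :=
        (continuous_aeval_complex p).comp (by fun_prop)
      exact (this.tendsto s).mono_left inf_le_left
    have hlim := limit_eq_zero_of_no_root_ball (fun s' => natDegree_linePoly_le p (A s') V) hc hno
      (g := fun t' => MvPolynomial.aeval (A s + t' • V) p) htend h
    exact hV (aeval_direction_eq_zero hp hlim)
  have hzero : (0 : unitInterval) ∉ E := fun ⟨t, ht, h⟩ => h0 t ht h
  rcases isClopen_iff.1 ⟨hclosed, hopen⟩ with h | h
  · intro t ht hh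
    have : (1 : unitInterval) ∈ E := ⟨t, ht, hh⟩
    rw [h] at this
    exact this
  · exact absurd (h ▸ Set.mem_univ _) hzero

end Homotopy

/-! ### Gårding's theory: change of direction and convexity of the cones -/

section Garding

variable {n : ℕ} {p : MvPolynomial (Fin n) ℝ} {d : ℕ} {e : Fin n → ℝ}

theorem aeval_complexify_ne_zero_iff {a : Fin n → ℝ} :
    MvPolynomial.aeval (complexify a) p ≠ 0 ↔ MvPolynomial.eval a p ≠ 0 := by
  rw [aeval_complexify, Ne, Complex.ofReal_eq_zero]

/-- `p` is homogeneous of degree `d`, does not vanish at `e`, and its restrictions to the real lines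
of direction `e` have no nonreal roots. -/
structure HyperbolicAlong (p : MvPolynomial (Fin n) ℝ) (d : ℕ) (e : Fin n → ℝ) : Prop where
  homogeneous : p.IsHomogeneous d
  ne_zero : MvPolynomial.eval e p ≠ 0
  nonreal : ∀ (a : Fin n → ℝ) (τ : ℂ), τ.im ≠ 0 →
    MvPolynomial.aeval (complexify a + τ • complexify e) p ≠ 0

/-- The points `v` such that `p` does not vanish on the ray from `v` in direction `e`. -/
def openCone (p : MvPolynomial (Fin n) ℝ) (e : Fin n → ℝ) : Set (Fin n → ℝ) :=
  {v | ∀ τ : ℝ, 0 ≤ τ → MvPolynomial.eval (v + τ • e) p ≠ 0}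

theorem eval_ne_zero_of_mem_openCone {v : Fin n → ℝ} (hv : v ∈ openCone p e) :
    MvPolynomial.eval v p ≠ 0 := by
  simpa using hv 0 le_rfl

theorem add_smul_mem_openCone {v : Fin n → ℝ} (hv : v ∈ openCone p e) {τ : ℝ} (hτ : 0 ≤ τ) :
    v + τ • e ∈ openCone p e := fun σ hσ => by
  rw [add_assoc, ← add_smul]
  exact hv _ (add_nonneg hτ hσ)

theorem eval_smul_ne_zero (hp : p.IsHomogeneous d) {t : ℝ} (ht : t ≠ 0) {z : Fin n → ℝ}
    (hz : MvPolynomial.eval z p ≠ 0) : MvPolynomial.eval (t • z) p ≠ 0 := by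
  rw [eval_smul_of_isHomogeneous hp]
  exact mul_ne_zero (pow_ne_zero _ ht) hz

theorem smul_mem_openCone (hp : p.IsHomogeneous d) {v : Fin n → ℝ} (hv : v ∈ openCone p e) {c : ℝ}
    (hc : 0 < c) : c • v ∈ openCone p e := fun τ hτ => by
  have : c • v + τ • e = c • (v + (τ / c) • e) := by
    rw [smul_add, smul_smul, mul_div_cancel₀ _ hc.ne']
  rw [this]
  exact eval_smul_ne_zero hp hc.ne' (hv _ (by positivity))

namespace HyperbolicAlong

theorem aeval_ne_zero (h : HyperbolicAlong p d e) : MvPolynomial.aeval (complexify e) p ≠ 0 :=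
  aeval_complexify_ne_zero_iff.2 h.ne_zero

/-- Nonreal combinations `τ • e + t • v` with `v` in the open cone. -/
theorem aeval_smul_add_smul_ne_zero (h : HyperbolicAlong p d e) {v : Fin n → ℝ} {t ζ : ℂ}
    (ht : t ≠ 0) (hreal : ∀ r : ℝ, ζ = r * t → MvPolynomial.eval (v + r • e) p ≠ 0) :
    MvPolynomial.aeval (ζ • complexify e + t • complexify v) p ≠ 0 := by
  have : ζ • complexify e + t • complexify v = t • (complexify v + (ζ / t) • complexify e) := by
    rw [smul_add, smul_smul, mul_div_cancel₀ _ ht, add_comm]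
  rw [this, aeval_smul_of_isHomogeneous h.homogeneous]
  refine mul_ne_zero (pow_ne_zero _ ht) ?_
  by_cases him : (ζ / t).im = 0
  · have hr : ζ / t = ((ζ / t).re : ℂ) := Complex.ext rfl (by simpa using him)
    rw [hr, ← complexify_smul, ← complexify_add, aeval_complexify_ne_zero_iff]
    refine hreal _ ?_
    rw [← hr, div_mul_cancel₀ _ ht]
  · exact h.nonreal _ _ him

/-- Homotopy contracting `a` to `0`. The term `i α e` keeps roots off the real axis, by
hyperbolicity along `e`. At the start, a zero of `i α e + t v` would have `i α = r t` with `r` real;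
positivity of the imaginary parts forces `r > 0`, so `v ∈ openCone p e` excludes it. -/
theorem aeval_upper_ne_zero (h : HyperbolicAlong p d e) {v : Fin n → ℝ} (hv : v ∈ openCone p e)
    (a : Fin n → ℝ) {α : ℝ} (hα : 0 < α) {t : ℂ} (ht : 0 < t.im) :
    MvPolynomial.aeval (complexify a + (α * Complex.I) • complexify e + t • complexify v) p
      ≠ 0 := by
  have key := no_root_of_homotopy h.homogeneous (V := complexify v)
    (aeval_complexify_ne_zero_iff.2 (eval_ne_zero_of_mem_openCone hv))
    (A := fun s => ((s : ℝ) : ℂ) • complexify a + (α * Complex.I) • complexify e) (by fun_prop)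
    (U := {t | 0 < t.im}) (W := {t | 0 ≤ t.im})
    (isOpen_lt continuous_const Complex.continuous_im)
    (isClosed_le continuous_const Complex.continuous_im) (fun t (ht : 0 < t.im) => ht.le)
    (fun s t (ht : 0 ≤ t.im) h0 => by
      refine lt_of_le_of_ne ht fun him => ?_
      have hr : t = (t.re : ℂ) := Complex.ext rfl (by simpa using him.symm)
      refine h.nonreal ((s : ℝ) • a + t.re • v) (α * Complex.I) (by simpa using hα.ne') ?_
      rw [complexify_add, complexify_smul, complexify_smul, ← hr, ← h0]
      congr 2
      abel)
    (fun t (ht : 0 < t.im) => by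
      simp only [Set.Icc.coe_zero, Complex.ofReal_zero, zero_smul, zero_add]
      refine h.aeval_smul_add_smul_ne_zero (by rintro rfl; simp at ht) fun r hr => hv r ?_
      have := congrArg Complex.im hr
      simp only [Complex.mul_im, Complex.ofReal_re, Complex.ofReal_im, Complex.I_re, Complex.I_im,
        zero_mul, add_zero, mul_one] at this
      by_contra! hneg
      nlinarith)
    t ht
  simpa using key

/-- Gårding: a hyperbolic polynomial is hyperbolic along every direction of its open cone. -/
theorem of_mem_openCone (h : HyperbolicAlong p d e) {v : Fin n → ℝ} (hv : v ∈ openCone p e) :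
    HyperbolicAlong p d v := by
  have hv0 := eval_ne_zero_of_mem_openCone hv
  have key : ∀ (a : Fin n → ℝ) (τ : ℂ), 0 < τ.im →
      MvPolynomial.aeval (complexify a + τ • complexify v) p ≠ 0 := fun a τ hτ h0 => by
    refine aeval_complexify_ne_zero_iff.2 hv0 (aeval_direction_eq_zero h.homogeneous
      (A := complexify a) ?_)
    -- Remove the perturbation `i α e` by letting `α → 0`; the disc of radius `τ.im` about `τ` stays
    -- in the upper half-plane.
    refine limit_eq_zero_of_no_root_ball (l := 𝓝[>] (0 : ℝ)) (c := τ.im) (t₀ := τ)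
      (P := fun α => linePoly p (complexify a + (α * Complex.I) • complexify e) (complexify v))
      (fun α => natDegree_linePoly_le p _ _) hτ ?_
      (g := fun t => MvPolynomial.aeval (complexify a + t • complexify v) p) (fun t => ?_) h0
    · filter_upwards [self_mem_nhdsWithin] with α hα t ht
      rw [eval_linePoly]
      refine h.aeval_upper_ne_zero hv a hα ?_
      have := (Complex.abs_im_le_norm (t - τ)).trans_lt ht
      rw [Complex.sub_im, abs_lt] at this
      linarith
    · simp only [eval_linePoly]
      have hc : Continuous fun α : ℝ => MvPolynomial.aeval
          (complexify a + (α * Complex.I) • complexify e + t • complexify v) p :=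
        (continuous_aeval_complex p).comp (by fun_prop)
      have := (hc.tendsto 0).mono_left (nhdsWithin_le_nhds (s := Set.Ioi 0))
      simpa using this
  refine ⟨h.homogeneous, hv0, fun a τ hτ => ?_⟩
  rcases hτ.lt_or_gt with hlt | hgt
  · have hneg : complexify a + τ • complexify v
        = (-1 : ℂ) • (complexify ((-1 : ℝ) • a) + (-τ) • complexify v) := by
      rw [complexify_smul]; module
    rw [hneg, aeval_smul_of_isHomogeneous h.homogeneous]
    exact mul_ne_zero (pow_ne_zero _ (by norm_num)) (key _ _ (by simpa using hlt))
  · exact key a τ hgt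

/-- The open cone is closed under addition. -/
theorem add_mem_openCone (h : HyperbolicAlong p d e) {v w : Fin n → ℝ} (hv : v ∈ openCone p e)
    (hw : w ∈ openCone p e) : w + v ∈ openCone p e := by
  -- The ray from `w + v` is absorbed into `v`, because `v + τ e` stays in the open cone.
  suffices H : ∀ v ∈ openCone p e, MvPolynomial.eval (w + v) p ≠ 0 by
    intro τ hτ
    rw [add_assoc]
    exact H _ (add_smul_mem_openCone hv hτ)
  intro v hv
  have hvh := h.of_mem_openCone hv
  have hnr : ∀ (a : Fin n → ℝ) (t : ℂ), MvPolynomial.eval a p ≠ 0 → 0 ≤ t.re →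
      MvPolynomial.aeval (complexify a + t • complexify v) p = 0 → 0 < t.re := by
    intro a t ha ht h0
    refine lt_of_le_of_ne ht fun hre => ?_
    have him : t.im = 0 := by
      by_contra him
      exact hvh.nonreal a t him h0
    have : t = 0 := Complex.ext hre.symm him
    rw [this, zero_smul, add_zero] at h0
    exact aeval_complexify_ne_zero_iff.2 ha h0
  -- Move `a` along the segment from `e` to `w`, where `p a ≠ 0`. Roots of `p (a + t v)` are real
  -- and never `0`, so none crosses the imaginary axis; the conclusion is used at `t = 1`.
  have key := no_root_of_homotopy h.homogeneous (V := complexify v)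
    (aeval_complexify_ne_zero_iff.2 hvh.ne_zero)
    (A := fun s => complexify ((1 - (s : ℝ)) • e + (s : ℝ) • w))
    (continuous_complexify.comp (by fun_prop))
    (U := {t | 0 < t.re}) (W := {t | 0 ≤ t.re})
    (isOpen_lt continuous_const Complex.continuous_re)
    (isClosed_le continuous_const Complex.continuous_re) (fun t (ht : 0 < t.re) => ht.le)
    (fun s t ht => hnr _ t (by
      rcases s.2.1.eq_or_lt with hs | hs
      · rw [← hs]
        simpa using h.ne_zero
      · have : (1 - (s : ℝ)) • e + (s : ℝ) • w = (s : ℝ) • (w + ((1 - (s : ℝ)) / s) • e) := by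
          rw [smul_add, smul_smul, mul_div_cancel₀ _ hs.ne', add_comm]
        rw [this]
        exact eval_smul_ne_zero h.homogeneous hs.ne'
          (hw _ (div_nonneg (by linarith [s.2.2]) hs.le))) ht)
    (fun t (ht : 0 < t.re) => by
      have ht0 : t ≠ 0 := by rintro rfl; simp at ht
      have := h.aeval_smul_add_smul_ne_zero (v := v) (t := t) (ζ := 1) ht0 fun r hr => hv r (by
        have h1 := congrArg Complex.re hr
        simp only [Complex.one_re, Complex.mul_re, Complex.ofReal_re, Complex.ofReal_im,
          zero_mul, sub_zero] at h1
        by_contra! hneg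
        nlinarith)
      simpa using this)
    1 (by simp)
  rw [← aeval_complexify_ne_zero_iff, complexify_add]
  simpa using key

end HyperbolicAlong

/-- The points `v` such that `v + τ e` is not a zero of `p` for any `τ > 0`. -/
def closedCone (p : MvPolynomial (Fin n) ℝ) (e : Fin n → ℝ) : Set (Fin n → ℝ) :=
  {v | ∀ τ : ℝ, 0 < τ → MvPolynomial.eval (v + τ • e) p ≠ 0}

theorem mem_closedCone_iff {v : Fin n → ℝ} :
    v ∈ closedCone p e ↔ ∀ τ : ℝ, 0 < τ → v + τ • e ∈ openCone p e := by
  refine ⟨fun hv τ hτ σ hσ => ?_, fun hv τ hτ => eval_ne_zero_of_mem_openCone (hv τ hτ)⟩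
  rw [add_assoc, ← add_smul]
  exact hv _ (by linarith)

theorem openCone_subset_closedCone : openCone p e ⊆ closedCone p e :=
  fun _ hv τ hτ => hv τ hτ.le

theorem smul_mem_closedCone (h : HyperbolicAlong p d e) {v : Fin n → ℝ} (hv : v ∈ closedCone p e)
    {c : ℝ} (hc : 0 ≤ c) : c • v ∈ closedCone p e := fun τ hτ => by
  rcases hc.eq_or_lt with rfl | hc
  · rw [zero_smul, zero_add]
    exact eval_smul_ne_zero h.homogeneous hτ.ne' h.ne_zero
  · have : c • v + τ • e = c • (v + (τ / c) • e) := by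
      rw [smul_add, smul_smul, mul_div_cancel₀ _ hc.ne']
    rw [this]
    exact eval_smul_ne_zero h.homogeneous hc.ne' (hv _ (by positivity))

theorem HyperbolicAlong.add_mem_closedCone (h : HyperbolicAlong p d e) {v w : Fin n → ℝ}
    (hv : v ∈ closedCone p e) (hw : w ∈ closedCone p e) : v + w ∈ closedCone p e := by
  rw [mem_closedCone_iff] at *
  intro τ hτ
  have : v + w + τ • e = (v + (τ / 2) • e) + (w + (τ / 2) • e) := by module
  rw [this]
  exact h.add_mem_openCone (hw _ (by positivity)) (hv _ (by positivity))

/-- The direction `e` is interior to the open cone: rescaling `e + z + τ e` by `(1 + τ)⁻¹` only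
brings it closer to `e`, so nonvanishing near `e` suffices. -/
theorem exists_forall_norm_lt_mem_openCone (h : HyperbolicAlong p d e) :
    ∃ δ > 0, ∀ z : Fin n → ℝ, ‖z‖ < δ → e + z ∈ openCone p e := by
  obtain ⟨δ, hδ, hb⟩ := Metric.eventually_nhds_iff.1
    ((MvPolynomial.continuous_eval p).continuousAt.eventually_ne h.ne_zero)
  refine ⟨δ, hδ, fun z hz τ hτ => ?_⟩
  have h1 : 0 < 1 + τ := by positivity
  have : e + z + τ • e = (1 + τ) • (e + (1 + τ)⁻¹ • z) := by
    rw [smul_add, smul_smul, mul_inv_cancel₀ h1.ne', one_smul, add_smul, one_smul]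
    abel
  rw [this]
  refine eval_smul_ne_zero h.homogeneous h1.ne' (hb ?_)
  rw [dist_eq_norm, add_sub_cancel_left, norm_smul, norm_inv, Real.norm_of_nonneg h1.le]
  refine lt_of_le_of_lt ?_ hz
  exact mul_le_of_le_one_left (norm_nonneg _) (inv_le_one_of_one_le₀ (by linarith))

theorem HyperbolicAlong.add_mem_openCone_of_closedCone (h : HyperbolicAlong p d e)
    {x v : Fin n → ℝ} (hx : x ∈ closedCone p e) (hv : v ∈ openCone p e) :
    x + v ∈ openCone p e := by
  have hc : Continuous fun τ : ℝ => MvPolynomial.eval (v + τ • e) p :=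
    (MvPolynomial.continuous_eval p).comp (by fun_prop)
  obtain ⟨δ, hδ, hb⟩ := Metric.eventually_nhds_iff.1 (hc.continuousAt.eventually_ne (hv 0 le_rfl))
  -- Openness of the cone in direction `-e` leaves a multiple of `e` that can be lent to `x`.
  have hv' : v + (-(δ / 2)) • e ∈ openCone p e := fun τ hτ => by
    rw [add_assoc, ← add_smul]
    rcases le_or_gt 0 (-(δ / 2) + τ) with h0 | h0
    · exact hv _ h0
    · refine hb ?_
      rw [Real.dist_eq, sub_zero, abs_lt]
      constructor <;> linarith
  have : x + v = (x + (δ / 2) • e) + (v + (-(δ / 2)) • e) := by module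
  rw [this]
  exact h.add_mem_openCone hv' (mem_closedCone_iff.1 hx _ (by positivity))

theorem HyperbolicAlong.aeval_ne_zero_of_re_pos (h : HyperbolicAlong p d e) {y : Fin n → ℝ}
    (hy : y ∈ closedCone p e) {t : ℂ} (ht : 0 < t.re) :
    MvPolynomial.aeval (complexify y + t • complexify e) p ≠ 0 := by
  by_cases him : t.im = 0
  · have hr : t = (t.re : ℂ) := Complex.ext rfl (by simpa using him)
    rw [hr, ← complexify_smul, ← complexify_add, aeval_complexify_ne_zero_iff]
    exact hy _ ht
  · exact h.nonreal _ _ him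

theorem re_pos_of_norm_sub_lt {t : ℂ} {τ : ℝ} (ht : ‖t - τ‖ < τ) : 0 < t.re := by
  have := (Complex.abs_re_le_norm (t - τ)).trans_lt ht
  rw [Complex.sub_re, Complex.ofReal_re, abs_lt] at this
  linarith

/-- The closed cone is topologically closed. -/
theorem HyperbolicAlong.isClosed_closedCone (h : HyperbolicAlong p d e) :
    IsClosed (closedCone p e) := by
  rw [← isSeqClosed_iff_isClosed]
  intro y y₀ hy hlim τ hτ h0
  refine h.aeval_ne_zero (aeval_direction_eq_zero h.homogeneous (A := complexify y₀) ?_)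
  refine limit_eq_zero_of_no_root_ball (l := atTop) (c := τ) (t₀ := τ)
    (P := fun k => linePoly p (complexify (y k)) (complexify e))
    (fun k => natDegree_linePoly_le p _ _) hτ ?_
    (g := fun t => MvPolynomial.aeval (complexify y₀ + t • complexify e) p) (fun t => ?_) ?_
  · refine Eventually.of_forall fun k t ht => ?_
    rw [eval_linePoly]
    exact h.aeval_ne_zero_of_re_pos (hy k) (re_pos_of_norm_sub_lt ht)
  · simp only [eval_linePoly]
    have hc : Continuous fun z => MvPolynomial.aeval (complexify z + t • complexify e) p :=
      (continuous_aeval_complex p).comp (by have := continuous_complexify (n := n); fun_prop)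
    exact (hc.tendsto y₀).comp hlim
  · rw [← complexify_smul, ← complexify_add, aeval_complexify, h0, Complex.ofReal_zero]

end Garding

/-! ### Eigenvalues and zeros of `p` on lines of direction `e` -/

section Bridge

variable {n : ℕ} {p : MvPolynomial (Fin n) ℝ} {e : Fin n → ℝ}

theorem aeval_charPoly (p : MvPolynomial (Fin n) ℝ) (e x : Fin n → ℝ) (τ : ℂ) :
    Polynomial.aeval τ (charPoly p e x)
      = MvPolynomial.aeval (complexify ((-1 : ℝ) • x) + τ • complexify e) p := by
  have h := MvPolynomial.comp_aeval_apply (R := ℝ)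
    (fun i => Polynomial.C (e i) * Polynomial.X - Polynomial.C (x i))
    (Polynomial.aeval τ : Polynomial ℝ →ₐ[ℝ] ℂ) p
  have h2 : (fun i => Polynomial.aeval τ
      (Polynomial.C (e i) * Polynomial.X - Polynomial.C (x i)))
      = complexify ((-1 : ℝ) • x) + τ • complexify e := by
    funext i
    simp only [map_sub, map_mul, Polynomial.aeval_C, Polynomial.aeval_X, complexify,
      Complex.coe_algebraMap, Pi.add_apply, Pi.smul_apply, smul_eq_mul]
    push_cast
    ring
  rw [charPoly, h, h2]

theorem natDegree_charPoly_le (p : MvPolynomial (Fin n) ℝ) (e x : Fin n → ℝ) :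
    (charPoly p e x).natDegree ≤ p.totalDegree := by
  have h := MvPolynomial.aeval_natDegree_le p le_rfl
    (fun i => Polynomial.C (e i) * Polynomial.X - Polynomial.C (x i)) (n := 1) fun i => by
      compute_degree
  rwa [mul_one] at h

/-- By homogeneity the quotient is `p (e - t⁻¹ x)`. The limit identifies both the degree and the
leading coefficient of `charPoly`. -/
theorem tendsto_eval_charPoly_div {d : ℕ} (hp : p.IsHomogeneous d) (e x : Fin n → ℝ) :
    Tendsto (fun t => (charPoly p e x).eval t / (Polynomial.X ^ d : Polynomial ℝ).eval t) atTop
      (𝓝 (MvPolynomial.eval e p)) := by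
  have hc : Continuous fun s : ℝ => MvPolynomial.eval (e - s • x) p :=
    (MvPolynomial.continuous_eval p).comp (by fun_prop)
  have h1 : Tendsto (fun t : ℝ => MvPolynomial.eval (e - t⁻¹ • x) p) atTop
      (𝓝 (MvPolynomial.eval e p)) := by
    have := (hc.tendsto 0).comp (tendsto_inv_atTop_zero (𝕜 := ℝ))
    simpa [Function.comp_def] using this
  refine h1.congr' ?_
  filter_upwards [eventually_gt_atTop 0] with t ht
  have : t • e - x = t • (e - t⁻¹ • x) := by
    rw [smul_sub, smul_smul, mul_inv_cancel₀ ht.ne', one_smul]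
  rw [eval_charPoly, this, eval_smul_of_isHomogeneous hp, Polynomial.eval_pow, Polynomial.eval_X,
    mul_div_cancel_left₀ _ (pow_ne_zero _ ht.ne')]

theorem degree_charPoly {d : ℕ} (hp : p.IsHomogeneous d) (he : MvPolynomial.eval e p ≠ 0)
    (x : Fin n → ℝ) : (charPoly p e x).degree = d := by
  have hlim := tendsto_eval_charPoly_div hp e x
  refine le_antisymm ?_ ?_
  · exact Polynomial.degree_le_of_natDegree_le
      ((natDegree_charPoly_le p e x).trans hp.totalDegree_le)
  · by_contra! hlt
    rw [← Polynomial.degree_X_pow (R := ℝ) d] at hlt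
    exact he (tendsto_nhds_unique hlim (Polynomial.div_tendsto_atTop_zero_of_degree_lt _ _ hlt))

theorem charPoly_ne_zero {d : ℕ} (hp : p.IsHomogeneous d) (he : MvPolynomial.eval e p ≠ 0)
    (x : Fin n → ℝ) : charPoly p e x ≠ 0 := by
  intro h
  have := degree_charPoly hp he x
  rw [h, Polynomial.degree_zero] at this
  simp at this

theorem leadingCoeff_charPoly {d : ℕ} (hp : p.IsHomogeneous d) (he : MvPolynomial.eval e p ≠ 0)
    (x : Fin n → ℝ) : (charPoly p e x).leadingCoeff = MvPolynomial.eval e p := by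
  have := Polynomial.div_tendsto_atTop_leadingCoeff_div_of_degree_eq (charPoly p e x)
    (Polynomial.X ^ d) (by rw [degree_charPoly hp he, Polynomial.degree_X_pow])
  rw [Polynomial.leadingCoeff_X_pow, div_one] at this
  exact tendsto_nhds_unique this (tendsto_eval_charPoly_div hp e x)

theorem IsHyperbolic.hyperbolicAlong (h : IsHyperbolic p e) :
    HyperbolicAlong p p.totalDegree e where
  homogeneous := h.homogeneous
  ne_zero := h.pos.ne'
  nonreal a τ hτ h0 := by
    have h1 : Polynomial.aeval τ (charPoly p e (-a)) = 0 := by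
      rw [aeval_charPoly, ← h0]
      simp
    have h2 := (h.real_roots (-a)).mem_range_of_isRoot (charPoly_ne_zero h.homogeneous h.pos.ne' _)
      (i := algebraMap ℝ ℂ) (x := τ) (by rwa [Polynomial.IsRoot, Polynomial.eval_map_algebraMap])
    obtain ⟨r, rfl⟩ := h2
    simp at hτ

theorem HyperbolicAlong.isHyperbolic (h : HyperbolicAlong p p.totalDegree e)
    (hpos : 0 < MvPolynomial.eval e p) : IsHyperbolic p e where
  homogeneous := h.homogeneous
  pos := hpos
  real_roots x := by
    refine Polynomial.Splits.of_splits_map (algebraMap ℝ ℂ) (IsAlgClosed.splits _) fun τ hτ => ?_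
    have h1 := Polynomial.isRoot_of_mem_roots hτ
    rw [Polynomial.IsRoot, Polynomial.eval_map_algebraMap, aeval_charPoly] at h1
    have him : τ.im = 0 := by
      by_contra him
      exact h.nonreal _ _ him h1
    exact ⟨τ.re, Complex.ext rfl (by simpa using him.symm)⟩

theorem eval_charPoly_eq_zero_iff {d : ℕ} (hp : p.IsHomogeneous d) (x : Fin n → ℝ) (t : ℝ) :
    (charPoly p e x).eval t = 0 ↔ MvPolynomial.eval (x + (-t) • e) p = 0 := by
  have : t • e - x = (-1 : ℝ) • (x + (-t) • e) := by module
  rw [eval_charPoly, this, eval_smul_of_isHomogeneous hp]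
  simp

/-- Up to sign `p (t e - x)` is `p (x - t e)`, so a negative eigenvalue `t` is a zero of `p (x + τ
e)` with `τ = -t > 0`. -/
theorem hyperbolicityCone_eq_closedCone {d : ℕ} (h : HyperbolicAlong p d e) :
    hyperbolicityCone p e = closedCone p e := by
  have hne := charPoly_ne_zero h.homogeneous h.ne_zero
  ext x
  simp only [hyperbolicityCone, eigenvalues, Set.mem_ofPred_eq, closedCone,
    Polynomial.mem_roots (hne x), Polynomial.IsRoot, eval_charPoly_eq_zero_iff h.homogeneous]
  constructor
  · intro hx τ hτ h0
    have := hx (-τ) (by rwa [neg_neg])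
    linarith
  · intro hx t ht
    by_contra! hneg
    exact hx (-t) (by linarith) ht

theorem rank_add_mult (p : MvPolynomial (Fin n) ℝ) (e x : Fin n → ℝ) :
    rank p e x + mult p e x = p.totalDegree := by
  refine Nat.add_sub_of_le ?_
  exact (Multiset.card_le_card (Multiset.filter_le _ _)).trans
    ((Polynomial.card_roots' _).trans (natDegree_charPoly_le p e x))

/-- In `p (x + ε e) = p e * ∏ (ε + λᵢ)` the zero eigenvalues contribute `ε ^ mult p e x`; `R`
collects the others, which are positive. -/
theorem exists_eval_add_smul_direction (h : IsHyperbolic p e) {x : Fin n → ℝ}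
    (hx : x ∈ hyperbolicityCone p e) :
    ∃ R : Polynomial ℝ, 0 < R.eval 0 ∧
      ∀ ε : ℝ, MvPolynomial.eval (x + ε • e) p = ε ^ mult p e x * R.eval ε := by
  set s := eigenvalues p e x with hs
  set s' := s.filter (fun t => t ≠ 0) with hs'
  have hcard : s.card = p.totalDegree := by
    rw [hs, eigenvalues, ← (h.real_roots x).natDegree_eq_card_roots]
    exact Polynomial.natDegree_eq_of_degree_eq_some (degree_charPoly h.homogeneous h.pos.ne' x)
  have hsplit : s' + s.filter (fun t => ¬ t ≠ 0) = s := Multiset.filter_add_not _ s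
  have hzero : s.filter (fun t => ¬ t ≠ 0) = Multiset.replicate (mult p e x) 0 := by
    refine Multiset.eq_replicate.2 ⟨?_, fun t ht => by simpa using (Multiset.mem_filter.1 ht).2⟩
    have h1 := congrArg Multiset.card hsplit
    have h2 : s'.card = rank p e x := rfl
    have h3 := rank_add_mult p e x
    rw [Multiset.card_add] at h1
    omega
  refine ⟨Polynomial.C (MvPolynomial.eval e p) *
    (s'.map fun a => Polynomial.X + Polynomial.C a).prod, ?_, fun ε => ?_⟩
  · rw [Polynomial.eval_mul, Polynomial.eval_C, Polynomial.eval_multiset_prod, Multiset.map_map]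
    refine mul_pos h.pos (Multiset.prod_pos fun b hb => ?_)
    obtain ⟨a, ha, rfl⟩ := Multiset.mem_map.1 hb
    obtain ⟨ha1, ha2⟩ := Multiset.mem_filter.1 ha
    simpa using lt_of_le_of_ne (hx a ha1) (Ne.symm ha2)
  · have h1 : x + ε • e = (-1 : ℝ) • ((-ε) • e - x) := by module
    rw [h1, eval_smul_of_isHomogeneous h.homogeneous, ← eval_charPoly,
      (h.real_roots x).eval_eq_prod_roots, leadingCoeff_charPoly h.homogeneous h.pos.ne']
    change _ * (_ * (s.map _).prod) = _
    have h2 : (-1 : ℝ) ^ p.totalDegree * (s.map fun a => -ε - a).prod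
        = (s.map fun a => ε + a).prod := by
      rw [← hcard, ← Multiset.card_map (fun a => -ε - a) s, ← Multiset.prod_map_neg,
        Multiset.map_map]
      congr 2
      funext a
      simp only [Function.comp_apply]
      ring
    have h3 : (s.map fun a => ε + a).prod = ε ^ mult p e x * (s'.map fun a => ε + a).prod := by
      conv_lhs => rw [← hsplit, hzero]
      rw [Multiset.map_add, Multiset.prod_add, Multiset.map_replicate, Multiset.prod_replicate,
        add_zero, mul_comm]
    rw [mul_left_comm, h2, h3, Polynomial.eval_mul, Polynomial.eval_C,
      Polynomial.eval_multiset_prod, Multiset.map_map]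
    have h4 : (Polynomial.eval ε ∘ fun a => Polynomial.X + Polynomial.C a) = fun a => ε + a := by
      funext a
      simp
    rw [h4]
    ring

end Bridge

/-! ### Order of vanishing at a point of the cone -/

section Order

variable {n : ℕ} {p : MvPolynomial (Fin n) ℝ} {d : ℕ} {e : Fin n → ℝ}

theorem coeff_eq_zero_of_abs_eval_le {S : Polynomial ℝ} {m : ℕ} {C : ℝ}
    (h : ∀ ε : ℝ, 0 < ε → ε < 1 → |S.eval ε| ≤ C * ε ^ m) : ∀ k < m, S.coeff k = 0 := by
  intro k
  induction k using Nat.strong_induction_on with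
  | _ k ih =>
    intro hk
    obtain ⟨T, rfl⟩ : Polynomial.X ^ k ∣ S :=
      Polynomial.X_pow_dvd_iff.2 fun j hj => ih j hj (hj.trans hk)
    have h0 : Tendsto (fun ε : ℝ => |T.eval ε|) (𝓝[>] 0) (𝓝 |T.eval 0|) :=
      (T.continuous.abs.tendsto 0).mono_left nhdsWithin_le_nhds
    have h1 : Tendsto (fun ε : ℝ => C * ε ^ (m - k)) (𝓝[>] 0) (𝓝 0) := by
      have hc : Continuous fun ε : ℝ => C * ε ^ (m - k) := by fun_prop
      have := (hc.tendsto 0).mono_left (nhdsWithin_le_nhds (s := Set.Ioi 0))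
      rwa [zero_pow (Nat.sub_ne_zero_of_lt hk), mul_zero] at this
    have h2 : |T.eval 0| ≤ 0 := le_of_tendsto_of_tendsto h0 h1 (by
      filter_upwards [Ioo_mem_nhdsGT (zero_lt_one' ℝ)] with ε hε
      have hpos : 0 < ε ^ k := pow_pos hε.1 k
      have := h ε hε.1 hε.2
      rw [Polynomial.eval_mul, Polynomial.eval_pow, Polynomial.eval_X, abs_mul, abs_of_pos hpos,
        ← Nat.sub_add_cancel hk.le, pow_add] at this
      refine le_of_mul_le_mul_left ?_ hpos
      linarith)
    rw [Polynomial.coeff_X_pow_mul', if_pos le_rfl, Nat.sub_self, Polynomial.coeff_zero_eq_eval_zero]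
    exact abs_nonpos_iff.1 h2

/-- At a point of the closed cone, the growth of `p` in an arbitrary direction is controlled by its
growth in direction `e`. -/
theorem HyperbolicAlong.exists_abs_eval_le (h : HyperbolicAlong p d e) (y : Fin n → ℝ) :
    ∃ C : ℝ, ∀ x ∈ closedCone p e, ∀ ε : ℝ, 0 < ε →
      |MvPolynomial.eval (x + ε • y) p| ≤ C * |MvPolynomial.eval (x + ε • e) p| := by
  obtain ⟨δ, hδ, hball⟩ := exists_forall_norm_lt_mem_openCone h
  set z := y - e with hz
  -- The factor `2` pays for giving half of `ε e` to `x`: `x + ε e + r ε z = (x + (ε/2) e) + (ε/2)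
  -- (e + 2 r z)`, where `e + 2 r z` must stay in the open cone.
  set c : ℝ := δ / (2 * (‖z‖ + 1)) with hc
  have hcpos : 0 < c := by positivity
  have hcz : ∀ r : ℝ, |r| < c → ‖(2 * r) • z‖ < δ := fun r hr => by
    rw [norm_smul, Real.norm_eq_abs, abs_mul, abs_two]
    rw [hc, lt_div_iff₀ (by positivity)] at hr
    nlinarith [norm_nonneg z, abs_nonneg r]
  refine ⟨(1 + ‖(1 : ℂ) - 0‖ / c) ^ (p.map (algebraMap ℝ ℂ)).totalDegree, fun x hx ε hε => ?_⟩
  have hv : x + ε • e ∈ openCone p e := mem_closedCone_iff.1 hx ε hε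
  have key := norm_eval_le_of_no_root_ball (natDegree_linePoly_le p (complexify (x + ε • e))
    (complexify (ε • z))) hcpos (t₀ := 0) (fun σ hσ => by
      rw [sub_zero] at hσ
      rw [eval_linePoly]
      by_cases him : σ.im = 0
      · have hr : σ = (σ.re : ℂ) := Complex.ext rfl (by simpa using him)
        rw [hr, ← complexify_smul, ← complexify_add, aeval_complexify_ne_zero_iff]
        have h1 := hball _ (hcz σ.re ((Complex.abs_re_le_norm σ).trans_lt hσ))
        have h2 := h.add_mem_openCone_of_closedCone
          (openCone_subset_closedCone (mem_closedCone_iff.1 hx (ε / 2) (by positivity)))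
          (smul_mem_openCone h.homogeneous h1 (half_pos hε))
        have h3 : x + ε • e + σ.re • ε • z
            = x + (ε / 2) • e + (ε / 2) • (e + (2 * σ.re) • z) := by module
        rw [h3]
        exact eval_ne_zero_of_mem_openCone h2
      -- For nonreal `σ`, hyperbolicity along `x + ε e` applies; the exceptional case `1 = r σ` with
      -- `r` real cannot occur.
      · have h1 := (h.of_mem_openCone hv).aeval_smul_add_smul_ne_zero (v := ε • z) (t := σ)
          (ζ := 1) (by rintro rfl; simp at him) fun r hr => by
            have hi := congrArg Complex.im hr
            have hre := congrArg Complex.re hr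
            simp only [Complex.one_im, Complex.mul_im, Complex.ofReal_re, Complex.ofReal_im,
              zero_mul, add_zero] at hi
            have : r = 0 := (mul_eq_zero.1 hi.symm).resolve_right him
            simp [this] at hre
        rwa [one_smul] at h1) 1
  rw [eval_linePoly, eval_linePoly, one_smul, zero_smul, add_zero, ← complexify_add,
    aeval_complexify, aeval_complexify, Complex.norm_real, Complex.norm_real] at key
  have h4 : x + ε • e + ε • z = x + ε • y := by rw [hz]; module
  rw [h4, mul_comm] at key
  exact key

end Order

/-! ### Taylor expansion of `p` at `x` -/

section Expansion

variable {n : ℕ} {A : Type*} [CommRing A] [Algebra ℝ A]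

/-- The polynomial `y ↦ p (x + y)`. -/
noncomputable def translate (p : MvPolynomial (Fin n) ℝ) (x : Fin n → ℝ) :
    MvPolynomial (Fin n) ℝ :=
  MvPolynomial.aeval (fun i => MvPolynomial.C (x i) + MvPolynomial.X i) p

/-- The homogeneous part of degree `k` of `p` at `x`. -/
noncomputable def taylorTerm (p : MvPolynomial (Fin n) ℝ) (x : Fin n → ℝ) (k : ℕ) :
    MvPolynomial (Fin n) ℝ :=
  MvPolynomial.homogeneousComponent k (translate p x)

theorem taylorTerm_isHomogeneous (p : MvPolynomial (Fin n) ℝ) (x : Fin n → ℝ) (k : ℕ) :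
    (taylorTerm p x k).IsHomogeneous k :=
  MvPolynomial.homogeneousComponent_isHomogeneous _ _

theorem taylorTerm_eq_zero_of_lt {p : MvPolynomial (Fin n) ℝ} {x : Fin n → ℝ} {k : ℕ}
    (hk : (translate p x).totalDegree < k) : taylorTerm p x k = 0 :=
  MvPolynomial.homogeneousComponent_eq_zero _ _ hk

theorem aeval_translate (p : MvPolynomial (Fin n) ℝ) (x : Fin n → ℝ) (Z : Fin n → A) :
    MvPolynomial.aeval Z (translate p x)
      = MvPolynomial.aeval ((fun i => algebraMap ℝ A (x i)) + Z) p := by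
  rw [translate, MvPolynomial.comp_aeval_apply]
  congr 2
  funext i
  rw [map_add, MvPolynomial.aeval_X, MvPolynomial.algHom_C, Pi.add_apply]

theorem aeval_add_smul_eq_sum (p : MvPolynomial (Fin n) ℝ) (x : Fin n → ℝ) (t : A) (Z : Fin n → A) :
    MvPolynomial.aeval ((fun i => algebraMap ℝ A (x i)) + t • Z) p
      = ∑ k ∈ Finset.range ((translate p x).totalDegree + 1),
          t ^ k * MvPolynomial.aeval Z (taylorTerm p x k) := by
  rw [← aeval_translate]
  conv_lhs => rw [← MvPolynomial.sum_homogeneousComponent (translate p x)]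
  rw [map_sum]
  exact Finset.sum_congr rfl fun k _ =>
    aeval_smul_of_isHomogeneous (taylorTerm_isHomogeneous p x k) t Z

/-- If `p` vanishes to order `m` at `x`, then `p (x + t Z) = t ^ m * rescaled p x m t Z`. -/
noncomputable def rescaled (p : MvPolynomial (Fin n) ℝ) (x : Fin n → ℝ) (m : ℕ) (t : A)
    (Z : Fin n → A) : A :=
  ∑ k ∈ Finset.range ((translate p x).totalDegree + 1),
    t ^ k * MvPolynomial.aeval Z (taylorTerm p x (m + k))

theorem aeval_add_smul_eq_pow_mul_rescaled {p : MvPolynomial (Fin n) ℝ} {x : Fin n → ℝ} {m : ℕ}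
    (hm : ∀ k < m, taylorTerm p x k = 0) (t : A) (Z : Fin n → A) :
    MvPolynomial.aeval ((fun i => algebraMap ℝ A (x i)) + t • Z) p = t ^ m * rescaled p x m t Z := by
  set D := (translate p x).totalDegree + 1 with hD
  -- Lengthening the sum to `m + D` terms adds only parts of degree above that of the translate,
  -- which vanish; the first `m` terms can then be split off.
  have h1 : MvPolynomial.aeval ((fun i => algebraMap ℝ A (x i)) + t • Z) p
      = ∑ k ∈ Finset.range (m + D), t ^ k * MvPolynomial.aeval Z (taylorTerm p x k) := by
    rw [aeval_add_smul_eq_sum, ← hD, add_comm m D, Finset.sum_range_add _ D m, left_eq_add]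
    refine Finset.sum_eq_zero fun k _ => ?_
    rw [taylorTerm_eq_zero_of_lt (by omega), map_zero, mul_zero]
  rw [h1, Finset.sum_range_add, Finset.sum_eq_zero, zero_add, rescaled, Finset.mul_sum]
  · exact Finset.sum_congr rfl fun k _ => by rw [pow_add, mul_assoc]
  · intro k hk
    rw [hm k (Finset.mem_range.1 hk), map_zero, mul_zero]

theorem rescaled_zero (p : MvPolynomial (Fin n) ℝ) (x : Fin n → ℝ) (m : ℕ) (Z : Fin n → A) :
    rescaled p x m 0 Z = MvPolynomial.aeval Z (taylorTerm p x m) := by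
  rw [rescaled, Finset.sum_range_succ']
  simp

theorem eval_add_smul_eq_pow_mul_rescaled {p : MvPolynomial (Fin n) ℝ} {x : Fin n → ℝ} {m : ℕ}
    (hm : ∀ k < m, taylorTerm p x k = 0) (t : ℝ) (z : Fin n → ℝ) :
    MvPolynomial.eval (x + t • z) p = t ^ m * rescaled p x m t z :=
  aeval_add_smul_eq_pow_mul_rescaled hm t z

theorem continuous_rescaled_real (p : MvPolynomial (Fin n) ℝ) (x : Fin n → ℝ) (m : ℕ) :
    Continuous fun u : ℝ × (Fin n → ℝ) => rescaled p x m u.1 u.2 := by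
  unfold rescaled
  refine continuous_finsetSum _ fun k _ => (continuous_fst.pow k).mul ?_
  simp only [MvPolynomial.aeval_eq_eval]
  exact (MvPolynomial.continuous_eval _).comp continuous_snd

theorem continuous_rescaled_complex (p : MvPolynomial (Fin n) ℝ) (x : Fin n → ℝ) (m : ℕ)
    (Z : Fin n → ℂ) : Continuous fun t : ℂ => rescaled p x m t Z := by
  unfold rescaled
  fun_prop

end Expansion

/-! ### Existence and hyperbolicity of the localization -/

section Localization

variable {n : ℕ} {p : MvPolynomial (Fin n) ℝ} {e x : Fin n → ℝ}

/-- The bound by the direction `e` gives `|p (x + ε y)| ≤ C' ε ^ mult p e x` for `0 < ε < 1`, so the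
low coefficients of this polynomial in `ε` vanish, for every `y`. -/
theorem taylorTerm_eq_zero_of_lt_mult (h : IsHyperbolic p e) (hx : x ∈ hyperbolicityCone p e) :
    ∀ k < mult p e x, taylorTerm p x k = 0 := by
  intro k hk
  by_cases hkD : (translate p x).totalDegree < k
  · exact taylorTerm_eq_zero_of_lt hkD
  have ha := h.hyperbolicAlong
  refine MvPolynomial.funext fun y => ?_
  rw [map_zero]
  obtain ⟨C, hC⟩ := ha.exists_abs_eval_le y
  obtain ⟨R, -, hR⟩ := exists_eval_add_smul_direction h hx
  have hx' := hx
  rw [hyperbolicityCone_eq_closedCone ha] at hx'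
  set S : Polynomial ℝ := ∑ k ∈ Finset.range ((translate p x).totalDegree + 1),
    Polynomial.monomial k (MvPolynomial.eval y (taylorTerm p x k)) with hS
  have hSe : ∀ ε, S.eval ε = MvPolynomial.eval (x + ε • y) p := fun ε => by
    have := aeval_add_smul_eq_sum p x ε y
    simp only [MvPolynomial.aeval_eq_eval] at this
    rw [hS, Polynomial.eval_finsetSum]
    simp only [Polynomial.eval_monomial]
    refine Eq.trans ?_ this.symm
    exact Finset.sum_congr rfl fun k _ => mul_comm _ _
  have hSc : S.coeff k = MvPolynomial.eval y (taylorTerm p x k) := by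
    rw [hS, Polynomial.finsetSum_coeff]
    simp only [Polynomial.coeff_monomial]
    rw [Finset.sum_ite_eq', if_pos (Finset.mem_range.2 (by omega))]
  obtain ⟨M, hM⟩ := (isCompact_Icc (a := (0 : ℝ)) (b := 1)).exists_bound_of_continuousOn
    R.continuous.continuousOn
  rw [← hSc]
  refine coeff_eq_zero_of_abs_eval_le (m := mult p e x) (C := |C| * M) (fun ε h0 h1 => ?_) k hk
  rw [hSe]
  refine (hC x hx' ε h0).trans ?_
  rw [hR, abs_mul, abs_of_pos (pow_pos h0 _)]
  have h2 := hM ε ⟨h0.le, h1.le⟩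
  rw [Real.norm_eq_abs] at h2
  calc C * (ε ^ mult p e x * |R.eval ε|) ≤ |C| * (ε ^ mult p e x * M) := by
        gcongr
        exact le_abs_self C
    _ = _ := by ring

/-- The localization of `p` at `x`: the homogeneous part of lowest degree of `y ↦ p (x + y)`. -/
noncomputable def localization (p : MvPolynomial (Fin n) ℝ) (e x : Fin n → ℝ) :
    MvPolynomial (Fin n) ℝ :=
  taylorTerm p x (mult p e x)

theorem rescaled_zero_eq_localization (p : MvPolynomial (Fin n) ℝ) (e x z : Fin n → ℝ) :
    rescaled p x (mult p e x) 0 z = MvPolynomial.eval z (localization p e x) :=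
  rescaled_zero p x _ z

/-- Both `rescaled p x m ε e` and `R ε` are `p (x + ε e) / ε ^ m` for `ε ≠ 0`, so they agree in the
limit, where `R 0 > 0`. -/
theorem eval_direction_localization_pos (h : IsHyperbolic p e) (hx : x ∈ hyperbolicityCone p e) :
    0 < MvPolynomial.eval e (localization p e x) := by
  obtain ⟨R, hR0, hR⟩ := exists_eval_add_smul_direction h hx
  have hz := taylorTerm_eq_zero_of_lt_mult h hx
  have hc : Continuous fun ε : ℝ => rescaled p x (mult p e x) ε e :=
    (continuous_rescaled_real p x _).comp (by fun_prop : Continuous fun ε : ℝ => (ε, e))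
  have h1 : Tendsto (fun ε : ℝ => rescaled p x (mult p e x) ε e) (𝓝[≠] 0)
      (𝓝 (rescaled p x (mult p e x) 0 e)) := (hc.tendsto 0).mono_left nhdsWithin_le_nhds
  have h2 : Tendsto (fun ε : ℝ => rescaled p x (mult p e x) ε e) (𝓝[≠] 0) (𝓝 (R.eval 0)) := by
    refine ((R.continuous.tendsto 0).mono_left nhdsWithin_le_nhds).congr' ?_
    filter_upwards [self_mem_nhdsWithin] with ε hε
    refine mul_left_cancel₀ (pow_ne_zero (mult p e x) hε) ?_
    rw [← hR, eval_add_smul_eq_pow_mul_rescaled hz]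
  rw [← rescaled_zero_eq_localization, tendsto_nhds_unique h1 h2]
  exact hR0

theorem isLocalization_localization (h : IsHyperbolic p e) (hx : x ∈ hyperbolicityCone p e) :
    IsLocalization p e x (localization p e x) := by
  have hz := taylorTerm_eq_zero_of_lt_mult h hx
  have hmult : ∀ y : Fin n → ℝ,
      Tendsto (fun l : ℝ => l ^ mult p e x * MvPolynomial.eval (x + l⁻¹ • y) p) atTop
        (𝓝 (MvPolynomial.eval y (localization p e x))) := fun y => by
    have hc : Continuous fun ε : ℝ => rescaled p x (mult p e x) ε y :=
      (continuous_rescaled_real p x _).comp (by fun_prop : Continuous fun ε : ℝ => (ε, y))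
    have h1 := (hc.tendsto 0).comp (tendsto_inv_atTop_zero (𝕜 := ℝ))
    rw [rescaled_zero_eq_localization] at h1
    refine h1.congr' ?_
    filter_upwards [eventually_gt_atTop 0] with l hl
    rw [eval_add_smul_eq_pow_mul_rescaled hz, ← mul_assoc, ← mul_pow, mul_inv_cancel₀ hl.ne',
      one_pow, one_mul, Function.comp_apply]
  refine ⟨?_, hmult, fun y => ?_⟩
  · refine (taylorTerm_isHomogeneous p x _).totalDegree fun h0 => ?_
    have := eval_direction_localization_pos h hx
    rw [localization, h0, map_zero] at this
    exact lt_irrefl _ this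
  · refine (hmult y).congr' ?_
    filter_upwards [eventually_gt_atTop 0] with l hl
    have h1 : l • x + y = l • (x + l⁻¹ • y) := by
      rw [smul_add, smul_smul, mul_inv_cancel₀ hl.ne', one_smul]
    rw [h1, eval_smul_of_isHomogeneous h.homogeneous, ← rank_add_mult p e x, pow_add, mul_assoc,
      inv_mul_cancel_left₀ (pow_ne_zero _ hl.ne')]

theorem aeval_add_smul_complexify_eq {m : ℕ} (hm : ∀ k < m, taylorTerm p x k = 0) (t : ℂ)
    (Z : Fin n → ℂ) :
    MvPolynomial.aeval (complexify x + t • Z) p = t ^ m * rescaled p x m t Z :=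
  aeval_add_smul_eq_pow_mul_rescaled hm t Z

/-- If `p (x + ε (a + t e))` has, for all small `ε > 0`, no zero `t` in a disc, then neither does the
localization at the centre of the disc. -/
theorem aeval_localization_ne_zero (h : IsHyperbolic p e) (hx : x ∈ hyperbolicityCone p e)
    (a : Fin n → ℝ) {t₀ : ℂ} {c : ℝ} (hc : 0 < c)
    (hne : ∀ᶠ ε : ℝ in 𝓝[>] 0, ∀ t : ℂ, ‖t - t₀‖ < c →
      MvPolynomial.aeval (complexify x + (ε : ℂ) • (complexify a + t • complexify e)) p ≠ 0) :
    MvPolynomial.aeval (complexify a + t₀ • complexify e) (localization p e x) ≠ 0 := by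
  intro h0
  have hz := taylorTerm_eq_zero_of_lt_mult h hx
  set m := mult p e x with hm
  -- Dividing by `ε ^ m` makes these polynomials in `t` converge to the localization without
  -- changing their zeros.
  have hev : ∀ (ε : ℝ) (t : ℂ),
      (Polynomial.C (((ε : ℂ) ^ m)⁻¹) * linePoly p (complexify (x + ε • a))
        ((ε : ℂ) • complexify e)).eval t = ((ε : ℂ) ^ m)⁻¹ *
        MvPolynomial.aeval (complexify x + (ε : ℂ) • (complexify a + t • complexify e)) p := by
    intro ε t
    have h1 : complexify (x + ε • a) + t • (ε : ℂ) • complexify e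
        = complexify x + (ε : ℂ) • (complexify a + t • complexify e) := by
      rw [complexify_add, complexify_smul]
      module
    rw [Polynomial.eval_mul, Polynomial.eval_C, eval_linePoly, h1]
  refine aeval_complexify_ne_zero_iff.2 (eval_direction_localization_pos h hx).ne'
    (aeval_direction_eq_zero (taylorTerm_isHomogeneous p x _) (A := complexify a) ?_)
  refine limit_eq_zero_of_no_root_ball (l := 𝓝[>] (0 : ℝ)) (c := c) (t₀ := t₀)
    (P := fun ε : ℝ => Polynomial.C (((ε : ℂ) ^ m)⁻¹) * linePoly p (complexify (x + ε • a))
        ((ε : ℂ) • complexify e))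
    (fun ε => (Polynomial.natDegree_C_mul_le _ _).trans (natDegree_linePoly_le p _ _)) hc ?_
    (g := fun t => MvPolynomial.aeval (complexify a + t • complexify e) (localization p e x))
    (fun t => ?_) h0
  · filter_upwards [hne, self_mem_nhdsWithin] with ε hε hpos t ht
    rw [hev]
    exact mul_ne_zero (inv_ne_zero (pow_ne_zero _ (Complex.ofReal_ne_zero.2 (ne_of_gt hpos))))
      (hε t ht)
  · simp only [hev]
    have hc : Continuous fun ε : ℝ => rescaled p x m (ε : ℂ) (complexify a + t • complexify e) :=
      (continuous_rescaled_complex p x m _).comp Complex.continuous_ofReal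
    have h1 := (hc.tendsto 0).mono_left (nhdsWithin_le_nhds (s := Set.Ioi 0))
    rw [Complex.ofReal_zero, rescaled_zero] at h1
    refine h1.congr' ?_
    filter_upwards [self_mem_nhdsWithin] with ε hε
    rw [aeval_add_smul_complexify_eq hz, inv_mul_cancel_left₀
      (pow_ne_zero _ (Complex.ofReal_ne_zero.2 (ne_of_gt hε)))]

theorem localization_hyperbolicAlong (h : IsHyperbolic p e) (hx : x ∈ hyperbolicityCone p e) :
    HyperbolicAlong (localization p e x) (mult p e x) e where
  homogeneous := taylorTerm_isHomogeneous p x _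
  ne_zero := (eval_direction_localization_pos h hx).ne'
  nonreal a τ hτ := by
    -- The disc of radius `|τ.im|` about `τ` misses the real axis, and multiplying by `ε > 0` keeps
    -- `t` nonreal.
    refine aeval_localization_ne_zero h hx a (abs_pos.2 hτ) ?_
    filter_upwards [self_mem_nhdsWithin] with ε hε t ht
    have h1 : complexify x + (ε : ℂ) • (complexify a + t • complexify e)
        = complexify (x + ε • a) + ((ε : ℂ) * t) • complexify e := by
      rw [complexify_add, complexify_smul]; module
    rw [h1]
    refine h.hyperbolicAlong.nonreal _ _ ?_
    rw [Complex.im_ofReal_mul]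
    refine mul_ne_zero (ne_of_gt hε) fun h0 => ?_
    have h2 := (Complex.abs_im_le_norm (t - τ)).trans_lt ht
    rw [Complex.sub_im, h0, zero_sub, abs_neg] at h2
    exact lt_irrefl _ h2

theorem localization_isHyperbolic (h : IsHyperbolic p e) (hx : x ∈ hyperbolicityCone p e) :
    IsHyperbolic (localization p e x) e := by
  refine HyperbolicAlong.isHyperbolic ?_ (eval_direction_localization_pos h hx)
  rw [(isLocalization_localization h hx).degree]
  exact localization_hyperbolicAlong h hx

end Localization

/-! ### The cone of the localization is the tangent cone -/

section TangentCone

variable {n : ℕ} {p : MvPolynomial (Fin n) ℝ} {e x : Fin n → ℝ}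

/-- By convexity `x + ε (z - x)` stays in the cone of `p` for `0 < ε < 1`, so `p` has no zero at its
translates by multiples of `e` with positive real part. The Hurwitz principle on the disc of centre
and radius `τ` carries this to the limit. -/
theorem sub_mem_closedCone_localization (h : IsHyperbolic p e) (hx : x ∈ hyperbolicityCone p e)
    {z : Fin n → ℝ} (hz : z ∈ hyperbolicityCone p e) :
    z - x ∈ closedCone (localization p e x) e := by
  have ha := h.hyperbolicAlong
  rw [hyperbolicityCone_eq_closedCone ha] at hz
  intro τ hτ
  rw [← aeval_complexify_ne_zero_iff, complexify_add, complexify_smul]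
  refine aeval_localization_ne_zero h hx (z - x) hτ ?_
  rw [hyperbolicityCone_eq_closedCone ha] at hx
  filter_upwards [Ioo_mem_nhdsGT (zero_lt_one' ℝ)] with ε hε t ht
  have h1 : complexify x + (ε : ℂ) • (complexify (z - x) + t • complexify e)
      = complexify ((1 - ε) • x + ε • z) + ((ε : ℂ) * t) • complexify e := by
    have h2 : (1 - ε) • x + ε • z = x + ε • (z - x) := by module
    rw [h2, complexify_add, complexify_smul]
    module
  rw [h1]
  refine ha.aeval_ne_zero_of_re_pos (ha.add_mem_closedCone
    (smul_mem_closedCone ha hx (by linarith [hε.2])) (smul_mem_closedCone ha hz hε.1.le)) ?_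
  rw [Complex.re_ofReal_mul]
  exact mul_pos hε.1 (re_pos_of_norm_sub_lt ht)

theorem tangentCone_subset (h : IsHyperbolic p e) (hx : x ∈ hyperbolicityCone p e) :
    tangentCone (hyperbolicityCone p e) x ⊆ closedCone (localization p e x) e := by
  have hl := localization_hyperbolicAlong h hx
  let K : PointedCone ℝ (Fin n → ℝ) :=
    { carrier := closedCone (localization p e x) e
      add_mem' := fun hv hw => hl.add_mem_closedCone hv hw
      zero_mem' := fun τ hτ => by
        rw [zero_add]
        exact eval_smul_ne_zero hl.homogeneous hτ.ne' hl.ne_zero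
      smul_mem' := fun c _ hv => smul_mem_closedCone hl hv c.2 }
  refine closure_minimal ?_ hl.isClosed_closedCone
  have : PointedCone.hull ℝ {v : Fin n → ℝ | ∃ z ∈ hyperbolicityCone p e, v = z - x} ≤ K := by
    refine Submodule.span_le.2 ?_
    rintro _ ⟨z, hz, rfl⟩
    exact sub_mem_closedCone_localization h hx hz
  exact this

/-- Points in the interior of the cone of the localization are feasible directions. -/
theorem exists_add_smul_mem (h : IsHyperbolic p e) (hx : x ∈ hyperbolicityCone p e)
    {y : Fin n → ℝ} (hy : y ∈ closedCone (localization p e x) e) {δ : ℝ} (hδ : 0 < δ) :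
    ∃ ε : ℝ, 0 < ε ∧ x + ε • (y + δ • e) ∈ hyperbolicityCone p e := by
  have ha := h.hyperbolicAlong
  have hz := taylorTerm_eq_zero_of_lt_mult h hx
  obtain ⟨ρ, hρ, hball⟩ := exists_forall_norm_lt_mem_openCone ha
  -- Since `e` is interior to the open cone of `p`, so is `e + y / M` for `M` large; beyond `M` the
  -- ray needs no smallness of `ε`.
  obtain ⟨M, hM0, hM⟩ : ∃ M : ℝ, 0 < M ∧ y + M • e ∈ openCone p e := by
    refine ⟨(‖y‖ + 1) / ρ, by positivity, ?_⟩
    have h1 : y + ((‖y‖ + 1) / ρ) • e = ((‖y‖ + 1) / ρ) • (e + (ρ / (‖y‖ + 1)) • y) := by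
      rw [smul_add, smul_smul, div_mul_div_cancel₀ hρ.ne', div_self (by positivity), one_smul,
        add_comm]
    rw [h1]
    refine smul_mem_openCone ha.homogeneous (hball _ ?_) (by positivity)
    rw [norm_smul, Real.norm_of_nonneg (by positivity), div_mul_eq_mul_div,
      div_lt_iff₀ (by positivity)]
    nlinarith
  -- At `ε = 0` the rescaled polynomial is the localization, nonzero on the compact segment because
  -- `δ > 0`; nonvanishing persists uniformly for small `ε`.
  have hcomp : ∀ᶠ ε : ℝ in 𝓝 0, ∀ τ ∈ Set.Icc δ M,
      rescaled p x (mult p e x) ε (y + τ • e) ≠ 0 := by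
    refine isCompact_Icc.eventually_forall_of_forall_eventually fun τ hτ => ?_
    have hc : Continuous fun u : ℝ × ℝ => rescaled p x (mult p e x) u.1 (y + u.2 • e) :=
      (continuous_rescaled_real p x _).comp
        (by fun_prop : Continuous fun u : ℝ × ℝ => (u.1, y + u.2 • e))
    refine hc.continuousAt.eventually_ne ?_
    rw [rescaled_zero_eq_localization]
    exact hy τ (hδ.trans_le hτ.1)
  obtain ⟨ε, hε, hpos⟩ :=
    ((hcomp.filter_mono (nhdsWithin_le_nhds (s := Set.Ioi 0))).and self_mem_nhdsWithin).exists
  have hpos : 0 < ε := hpos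
  refine ⟨ε, hpos, ?_⟩
  rw [hyperbolicityCone_eq_closedCone ha] at hx ⊢
  refine openCone_subset_closedCone fun τ hτ => ?_
  have h1 : x + ε • (y + δ • e) + τ • e = x + ε • (y + (δ + τ / ε) • e) := by
    rw [add_smul, ← add_assoc y, smul_add ε _ ((τ / ε) • e), smul_smul, mul_div_cancel₀ _ hpos.ne',
      add_assoc]
  have h2 : δ ≤ δ + τ / ε := le_add_of_nonneg_right (by positivity)
  rw [h1]
  -- Below `M` the rescaled polynomial is nonzero by the choice of `ε`; above `M` the point is `x`
  -- plus an element of the open cone.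
  rcases le_total (δ + τ / ε) M with hle | hle
  · rw [eval_add_smul_eq_pow_mul_rescaled hz]
    exact mul_ne_zero (pow_ne_zero _ hpos.ne') (hε _ ⟨h2, hle⟩)
  · have h3 := add_smul_mem_openCone hM (sub_nonneg.2 hle)
    rw [add_assoc, ← add_smul, add_sub_cancel] at h3
    exact eval_ne_zero_of_mem_openCone (ha.add_mem_openCone_of_closedCone hx
      (smul_mem_openCone ha.homogeneous h3 hpos))

theorem subset_tangentCone (h : IsHyperbolic p e) (hx : x ∈ hyperbolicityCone p e) :
    closedCone (localization p e x) e ⊆ tangentCone (hyperbolicityCone p e) x := by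
  intro y hy
  have hc : Continuous fun δ : ℝ => y + δ • e := by fun_prop
  have h1 := (hc.tendsto 0).mono_left (nhdsWithin_le_nhds (s := Set.Ioi 0))
  rw [zero_smul, add_zero] at h1
  refine mem_closure_of_tendsto h1 ?_
  filter_upwards [self_mem_nhdsWithin] with δ hδ
  obtain ⟨ε, hε, hmem⟩ := exists_add_smul_mem h hx hy hδ
  have h2 : y + δ • e = (⟨ε⁻¹, by positivity⟩ : {c : ℝ // 0 ≤ c}) • (ε • (y + δ • e)) := by
    change _ = ε⁻¹ • (ε • (y + δ • e))
    rw [smul_smul, inv_mul_cancel₀ hε.ne', one_smul]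
  rw [h2]
  refine Submodule.smul_mem (PointedCone.hull ℝ _) _ (Submodule.subset_span ⟨_, hmem, ?_⟩)
  rw [add_sub_cancel_left]

end TangentCone

end HypPoly

theorem theorem5p7 (n : ℕ) (p : MvPolynomial (Fin n) ℝ) (e x : Fin n → ℝ)
    (hp : HypPoly.IsHyperbolic p e) (hx : x ∈ HypPoly.hyperbolicityCone p e) :
    ∃ q : MvPolynomial (Fin n) ℝ,
      HypPoly.IsLocalization p e x q ∧
      (∀ q' : MvPolynomial (Fin n) ℝ, HypPoly.IsLocalization p e x q' → q' = q) ∧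
      HypPoly.IsHyperbolic q e ∧
      HypPoly.hyperbolicityCone q e
        = HypPoly.tangentCone (HypPoly.hyperbolicityCone p e) x := by
  have hq := HypPoly.isLocalization_localization hp hx
  -- Uniqueness: the limits fix every value, and a real polynomial is determined by its values.
  refine ⟨HypPoly.localization p e x, hq, fun q' hq' => MvPolynomial.funext fun y =>
    tendsto_nhds_unique (hq'.tendsto_mult y) (hq.tendsto_mult y),
    HypPoly.localization_isHyperbolic hp hx, ?_⟩
  rw [HypPoly.hyperbolicityCone_eq_closedCone (HypPoly.localization_hyperbolicAlong hp hx)]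
  exact (HypPoly.subset_tangentCone hp hx).antisymm (HypPoly.tangentCone_subset hp hx)
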